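/- Let $K=\mathbb{Q}(a,s,t)$, where $a,s,t$ are independent indeterminates. Call $(x,y,z)\in K^3$ a solution of Euler's shape if $xyz(x+y+z)=a$ and, for some nonzero $A,B,C\in K$, $$x=\frac{6ast^3A^2}{BC},\qquad y=\frac32\,\frac{s^5B^2}{tAC},\qquad z=\frac23\,\frac{C}{s^3tB}.$$ (1) For nonzero $A,B,C\in K$, put $U=A/B$ and $V=\dfrac{C(1-4U)}{3s^2B}$. The triple $(x,y,z)$ above satisfies $xyz(x+y+z)=a$ if and only if $36as^4t^4A^3+9s^8B^3+4C^2A=C^2B$, and if and only if $U\ne\frac14$ and $$V^2=-16at^4U^4+4at^4U^3-4s^4U+s^4 .$$ (2) Let $E$ be the curve $$E:\;Y^2-4s^2XY+8s^2at^4Y=X^3-4s^4X^2+64at^4s^4X-256at^4s^8 ,$$ and let $O$ be its point at infinity. It is an elliptic curve over $K$ containing the points $P=(4s^4,\;16s^6-8s^2at^4)$ and $T=(16s^4,\;96s^6)$. Sending the solution given by $A,B,C$ to the point $$X=\frac{2s^2(V+s^2)-4s^4U}{U^2},\qquad Y=\frac{4s^4(V+s^2)-8s^6U-8s^6U^2}{U^3}$$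 is a well-defined bijection from the set of solutions of Euler's shape onto $E(K)\setminus\{O,P,T\}$. (3) The point $P$ has infinite order. For every integer $n\neq 0,1$ the multiple $nP$ corresponds under (2) to exactly one solution of Euler's shape, and distinct $n$ give distinct solutions. In particular there are infinitely many solutions of Euler's shape. (4) The point $2P$ gives Euler's solution $$x=\frac{6ast^3(at^4-2s^4)^2}{(4at^4+s^4)\,c},\quad y=\frac32\,\frac{s^5(4at^4+s^4)^2}{t(at^4-2s^4)\,c},\quad z=\frac23\,\frac{c}{s^3t(4at^4+s^4)},$$ where $c=2a^2t^8+10as^4t^4-s^8$. (5) The point $3P$ gives the solution $$x=\frac{18as^5t^3(at^4-2s^4)^2c^2g}{(at^4+s^4)hd},\quad y=-\frac16\,\frac{(at^4+s^4)^2h^2g}{s^3t(at^4-2s^4)\,c\,d},\quad z=\frac{2sd}{t(at^4+s^4)gh},$$ where $g=a^2t^8+14at^4s^4-5s^8$, $h=a^3t^{12}+3s^4a^2t^8+111at^4s^8+s^{12}$ and $d=a^6t^{24}+6s^4a^5t^{20}-255s^8a^4t^{16}-790s^{12}a^3t^{12}-2253s^{16}a^2t^8-264s^{20}at^4+s^{24}$.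 (6) For every fixed nonzero rational number $a$, with $s,t$ indeterminates and $K=\mathbb{Q}(s,t)$, the curve $E$ is again an elliptic curve over $K$ containing $P$, and (3), (4), (5) hold, with the correspondence given by the formulas in (1) and (2). -/

import Mathlib

/-- The field `ℚ(X₀, …, X_{n-1})` of rational functions in `n` indeterminates over `ℚ`. -/
abbrev ParamField (n : ℕ) : Type := FractionRing (MvPolynomial (Fin n) ℚ)

/-- The `i`-th indeterminate of `ℚ(X₀, …, X_{n-1})`. -/
noncomputable def param {n : ℕ} (i : Fin n) : ParamField n :=
  algebraMap (MvPolynomial (Fin n) ℚ) (ParamField n) (MvPolynomial.X i)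

section Euler

variable {K : Type*} [Field K]

/-- The triple of Euler's shape with auxiliary parameters `A, B, C`:
`x = 6 a s t³ A² / (B C)`, `y = (3/2) s⁵ B² / (t A C)`, `z = (2/3) C / (s³ t B)`. -/
def eulerTriple (a s t A B C : K) : K × K × K :=
  (6 * a * s * t ^ 3 * A ^ 2 / (B * C),
    3 / 2 * (s ^ 5 * B ^ 2 / (t * A * C)),
    2 / 3 * (C / (s ^ 3 * t * B)))

/-- `p = (x, y, z)` satisfies `x y z (x + y + z) = a`. -/
def IsSolution (a : K) (p : K × K × K) : Prop :=
  p.1 * p.2.1 * p.2.2 * (p.1 + p.2.1 + p.2.2) = a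

/-- `p` is a solution of `x y z (x + y + z) = a` of Euler's shape. -/
def IsEulerSolution (a s t : K) (p : K × K × K) : Prop :=
  ∃ A B C : K, A ≠ 0 ∧ B ≠ 0 ∧ C ≠ 0 ∧ p = eulerTriple a s t A B C ∧ IsSolution a p

/-- The elliptic curve
`Y² - 4s²XY + 8s²at⁴Y = X³ - 4s⁴X² + 64at⁴s⁴X - 256at⁴s⁸`. -/
def eulerCurve (a s t : K) : WeierstrassCurve.Affine K where
  a₁ := -4 * s ^ 2
  a₂ := -4 * s ^ 4
  a₃ := 8 * s ^ 2 * (a * t ^ 4)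
  a₄ := 64 * (a * t ^ 4) * s ^ 4
  a₆ := -256 * (a * t ^ 4) * s ^ 8

/-- The coordinate `V = C (1 - 4U) / (3 s² B)`, with `U = A / B`, on the quartic curve
`V² = -16at⁴U⁴ + 4at⁴U³ - 4s⁴U + s⁴`. -/
def quarticV (s A B C : K) : K := C * (1 - 4 * (A / B)) / (3 * s ^ 2 * B)

/-- The `X`-coordinate of the image on the elliptic curve of the point `(U, V)`, `U ≠ 0`, of the
quartic. -/
def curveX (s U V : K) : K := (2 * s ^ 2 * (V + s ^ 2) - 4 * s ^ 4 * U) / U ^ 2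

/-- The `Y`-coordinate of the image on the elliptic curve of the point `(U, V)`, `U ≠ 0`, of the
quartic. -/
def curveY (s U V : K) : K :=
  (4 * s ^ 4 * (V + s ^ 2) - 8 * s ^ 6 * U - 8 * s ^ 6 * U ^ 2) / U ^ 3

/-- The solution `p` of Euler's shape corresponds to the point `Q` of the elliptic curve: `p` comes
from some `A, B, C`, and `Q` is the image of the point `(U, V) = (A / B, C (1 - 4U) / (3 s² B))`
of the quartic. -/
def Corresponds (a s t : K) (p : K × K × K) (Q : (eulerCurve a s t).Point) : Prop :=
  ∃ A B C : K, A ≠ 0 ∧ B ≠ 0 ∧ C ≠ 0 ∧ p = eulerTriple a s t A B C ∧ IsSolution a p ∧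
    ∃ h : (eulerCurve a s t).Nonsingular
        (curveX s (A / B) (quarticV s A B C)) (curveY s (A / B) (quarticV s A B C)),
      Q = WeierstrassCurve.Affine.Point.some _ _ h

/-- Euler's solution. -/
def euler1749 (a s t : K) : K × K × K :=
  (6 * a * s * t ^ 3 * (a * t ^ 4 - 2 * s ^ 4) ^ 2 /
      ((4 * a * t ^ 4 + s ^ 4) * (2 * a ^ 2 * t ^ 8 + 10 * a * s ^ 4 * t ^ 4 - s ^ 8)),
    3 / 2 * (s ^ 5 * (4 * a * t ^ 4 + s ^ 4) ^ 2 /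
      (t * (a * t ^ 4 - 2 * s ^ 4) * (2 * a ^ 2 * t ^ 8 + 10 * a * s ^ 4 * t ^ 4 - s ^ 8))),
    2 / 3 * ((2 * a ^ 2 * t ^ 8 + 10 * a * s ^ 4 * t ^ 4 - s ^ 8) /
      (s ^ 3 * t * (4 * a * t ^ 4 + s ^ 4))))

/-- The factor of degree 24 in the new solution. -/
def newD (a s t : K) : K :=
  a ^ 6 * t ^ 24 + 6 * s ^ 4 * a ^ 5 * t ^ 20 - 255 * s ^ 8 * a ^ 4 * t ^ 16
    - 790 * a ^ 3 * t ^ 12 * s ^ 12 - 2253 * a ^ 2 * t ^ 8 * s ^ 16 - 264 * s ^ 20 * a * t ^ 4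
    + s ^ 24

/-- The factor of degree 12 in the new solution. -/
def newH (a s t : K) : K :=
  a ^ 3 * t ^ 12 + 3 * s ^ 4 * a ^ 2 * t ^ 8 + 111 * a * t ^ 4 * s ^ 8 + s ^ 12

/-- The factor of degree 8 in the new solution. -/
def newG (a s t : K) : K := a ^ 2 * t ^ 8 - 5 * s ^ 8 + 14 * a * t ^ 4 * s ^ 4

/-- The new solution. -/
def newSolution (a s t : K) : K × K × K :=
  (18 * a * s ^ 5 * t ^ 3 * (-2 * s ^ 4 + a * t ^ 4) ^ 2 *
        (-s ^ 8 + 10 * a * t ^ 4 * s ^ 4 + 2 * a ^ 2 * t ^ 8) ^ 2 * newG a s t /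
      ((a * t ^ 4 + s ^ 4) * newH a s t * newD a s t),
    1 / 6 * (-((a * t ^ 4 + s ^ 4) ^ 2 * newH a s t ^ 2 * newG a s t) /
      (s ^ 3 * t * (-2 * s ^ 4 + a * t ^ 4) *
        (-s ^ 8 + 10 * a * t ^ 4 * s ^ 4 + 2 * a ^ 2 * t ^ 8) * newD a s t)),
    2 * s * newD a s t / (newG a s t * t * (a * t ^ 4 + s ^ 4) * newH a s t))

/-- The multiples `n • P` of the point `P = (4s⁴, 16s⁶ - 8s²at⁴)` of the elliptic curve give
infinitely many distinct solutions of Euler's shape: the curve is elliptic, `P` lies on it and has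
infinite order, every `n • P` with `n ≠ 0, 1` corresponds to exactly one solution, distinct `n`
give distinct solutions, `2 • P` gives Euler's solution and `3 • P` gives the new solution. -/
def MultiplesGiveInfinitelyMany [DecidableEq K] (a s t : K) : Prop :=
  (eulerCurve a s t).IsElliptic ∧
  ∃ hP : (eulerCurve a s t).Nonsingular (4 * s ^ 4) (16 * s ^ 6 - 8 * s ^ 2 * (a * t ^ 4)),
    let P : (eulerCurve a s t).Point := WeierstrassCurve.Affine.Point.some _ _ hP
    (∀ n : ℕ, 0 < n → n • P ≠ 0) ∧
    (∀ n : ℤ, n ≠ 0 → n ≠ 1 → ∃! p : K × K × K, Corresponds a s t p (n • P)) ∧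
    (∀ (m n : ℤ) (p : K × K × K),
      Corresponds a s t p (m • P) → Corresponds a s t p (n • P) → m = n) ∧
    Corresponds a s t (euler1749 a s t) (2 • P) ∧
    Corresponds a s t (newSolution a s t) (3 • P) ∧
    {p : K × K × K | IsEulerSolution a s t p}.Infinite

end Euler

/-! ### The correspondence between Euler's shape, the quartic and the elliptic curve. -/

section Euler

variable {K : Type*} [Field K]

/-! Write e = at⁴ and U = A/B. Euler's shape leads to the quartic V² = (1 - 4U)(4eU³ + s⁴). The
equation of E reads Y·N = (X - 4s⁴)·D with N = Y - 4s²X + 8s²e and D = X² + 64es⁴. The map from the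
quartic satisfies UY = 2s²(X - 4s⁴) (`curveY_mul`), and the quartic equation is equivalent to UD =
2s²N (`onQuartic_iff`). Hence U = 2s²N/D inverts the map when D ≠ 0, except at P, where N = 0. Of
the remaining points, U = 1/4 gives T, and V = 0 with U ≠ 1/4 would need 4eU³ + s⁴ = 0. Over
ℚ(a,s,t) neither D nor this cubic vanishes, by the degree in a modulo 2 (`sq_add_ne_zero`) and in t
modulo 3 (`add_pow_four_ne_zero`).

For the multiples of P, specialize to s = 1, t = 0. The curve becomes the cuspidal cubic (Y - 2X)² =
X³, whose smooth points form the additive group, with P going to 1; so nP goes to (4/n², 8/n³ +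
8/n²) for n ≠ 0 (`hasReduction_zsmul`). Therefore nP ≠ O, D specializes to 16/n⁴ ≠ 0, and nP ≠ T
because 4/n² ≠ 16. This also covers a fixed rational a, where -a may be a square and D may have
zeros. The same specialization shows that the polynomials in the formulas for 2P and 3P are nonzero.
-/

lemma eulerTriple_eq_div (a s t A C : K) {B : K} (hB : B ≠ 0) :
    eulerTriple a s t A B C = eulerTriple a s t (A / B) 1 (C / B) := by
  simp only [eulerTriple, Prod.mk.injEq, one_mul, mul_one, one_pow]
  refine ⟨?_, ?_, ?_⟩ <;> field_simp

lemma equation_eulerCurve_iff (a s t X Y : K) :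
    (eulerCurve a s t).Equation X Y ↔
      Y * (Y - 4 * s ^ 2 * X + 8 * s ^ 2 * (a * t ^ 4)) =
        (X - 4 * s ^ 4) * (X ^ 2 + 64 * (a * t ^ 4) * s ^ 4) := by
  rw [WeierstrassCurve.Affine.equation_iff]
  simp only [eulerCurve]
  constructor <;> intro h <;> linear_combination h

lemma eulerCurve_Δ (a s t : K) :
    (eulerCurve a s t).Δ =
      -110592 * (a * t ^ 4) ^ 2 * s ^ 8 * (a * t ^ 4 + 16 * s ^ 4) ^ 2 := by
  simp only [eulerCurve, WeierstrassCurve.Δ, WeierstrassCurve.b₂, WeierstrassCurve.b₄,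
    WeierstrassCurve.b₆, WeierstrassCurve.b₈]
  ring

/-- The quartic curve `V² = (1 - 4U)(4at⁴U³ + s⁴)`. -/
def OnQuartic (a s t U V : K) : Prop :=
  V ^ 2 = (1 - 4 * U) * (4 * (a * t ^ 4) * U ^ 3 + s ^ 4)

lemma Corresponds.isEulerSolution {a s t : K} {p : K × K × K} {Q : (eulerCurve a s t).Point}
    (h : Corresponds a s t p Q) : IsEulerSolution a s t p := by
  obtain ⟨A, B, C, hA, hB, hC, hp, hsol, -⟩ := h
  exact ⟨A, B, C, hA, hB, hC, hp, hsol⟩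

lemma curveY_mul {s U : K} (V : K) (hU : U ≠ 0) :
    curveY s U V * U = 2 * s ^ 2 * (curveX s U V - 4 * s ^ 4) := by
  unfold curveX curveY
  field_simp
  ring

variable [CharZero K]

lemma eulerTriple_one_injective {a s t U U' W W' : K} (hs : s ≠ 0) (ht : t ≠ 0)
    (hU : U ≠ 0) (hU' : U' ≠ 0) (hW' : W' ≠ 0)
    (h : eulerTriple a s t U 1 W = eulerTriple a s t U' 1 W') : U = U' ∧ W = W' := by
  simp only [eulerTriple, Prod.mk.injEq, one_mul, mul_one, one_pow] at h
  obtain ⟨-, h2, h3⟩ := h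
  field_simp at h3
  subst h3
  field_simp at h2
  exact ⟨h2.symm, rfl⟩

lemma isSolution_eulerTriple_iff_cubic {a s t A B C : K} (ha : a ≠ 0) (hs : s ≠ 0) (ht : t ≠ 0)
    (hA : A ≠ 0) (hB : B ≠ 0) (hC : C ≠ 0) :
    IsSolution a (eulerTriple a s t A B C) ↔
      36 * a * s ^ 4 * t ^ 4 * A ^ 3 + 9 * s ^ 8 * B ^ 3 + 4 * C ^ 2 * A = C ^ 2 * B := by
  have key : (6 * a * s * t ^ 3 * A ^ 2 / (B * C)) * (3 / 2 * (s ^ 5 * B ^ 2 / (t * A * C))) *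
      (2 / 3 * (C / (s ^ 3 * t * B))) * ((6 * a * s * t ^ 3 * A ^ 2 / (B * C)) +
        (3 / 2 * (s ^ 5 * B ^ 2 / (t * A * C))) + (2 / 3 * (C / (s ^ 3 * t * B)))) - a =
      a / (C ^ 2 * B) * (36 * a * s ^ 4 * t ^ 4 * A ^ 3 + 9 * s ^ 8 * B ^ 3 + 4 * C ^ 2 * A
        - C ^ 2 * B) := by
    field_simp
    ring
  have hne : a / (C ^ 2 * B) ≠ 0 := by simp [*]
  simp only [IsSolution, eulerTriple]
  rw [← sub_eq_zero, key, mul_eq_zero, or_iff_right hne, sub_eq_zero]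

/-- The two relations differ by the factor 1 - 4U. If U = 1/4, the terms in C cancel and the cubic
collapses to 36s⁴A³(at⁴ + 16s⁴) = 0, which `hd` forbids. -/
lemma cubic_iff_quartic {a s t A B : K} (C : K) (hs : s ≠ 0) (hA : A ≠ 0) (hB : B ≠ 0)
    (hd : a * t ^ 4 + 16 * s ^ 4 ≠ 0) :
    36 * a * s ^ 4 * t ^ 4 * A ^ 3 + 9 * s ^ 8 * B ^ 3 + 4 * C ^ 2 * A = C ^ 2 * B ↔
      A / B ≠ 1 / 4 ∧
      quarticV s A B C ^ 2 = -16 * a * t ^ 4 * (A / B) ^ 4 + 4 * a * t ^ 4 * (A / B) ^ 3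
        - 4 * s ^ 4 * (A / B) + s ^ 4 := by
  have key : quarticV s A B C ^ 2 - (-16 * a * t ^ 4 * (A / B) ^ 4 + 4 * a * t ^ 4 * (A / B) ^ 3
        - 4 * s ^ 4 * (A / B) + s ^ 4) = (1 - 4 * (A / B)) / (9 * s ^ 4 * B ^ 3) *
        (C ^ 2 * B - (36 * a * s ^ 4 * t ^ 4 * A ^ 3 + 9 * s ^ 8 * B ^ 3 + 4 * C ^ 2 * A)) := by
    unfold quarticV
    field_simp
    ring
  rw [← sub_eq_zero (a := quarticV s A B C ^ 2), key]
  constructor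
  · intro h
    refine ⟨fun hU => ?_, by rw [h, sub_self, mul_zero]⟩
    have hBA : B = 4 * A := by field_simp at hU; rw [← hU]; ring
    subst hBA
    have : 36 * s ^ 4 * A ^ 3 * (a * t ^ 4 + 16 * s ^ 4) = 0 := by linear_combination h
    simp_all
  · rintro ⟨hU, h⟩
    have h1 : 1 - 4 * (A / B) ≠ 0 := fun h0 => hU (by linear_combination (-1 / 4) * h0)
    have h2 : (1 - 4 * (A / B)) / (9 * s ^ 4 * B ^ 3) ≠ 0 :=
      div_ne_zero h1 (by simp [*])
    linear_combination -((mul_eq_zero.1 h).resolve_left h2)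

lemma onQuartic_iff {a s t U V : K} (hs : s ≠ 0) (hU : U ≠ 0) :
    OnQuartic a s t U V ↔ U * (curveX s U V ^ 2 + 64 * (a * t ^ 4) * s ^ 4) =
      2 * s ^ 2 * (curveY s U V - 4 * s ^ 2 * curveX s U V + 8 * s ^ 2 * (a * t ^ 4)) := by
  have key : U * (curveX s U V ^ 2 + 64 * (a * t ^ 4) * s ^ 4) -
      2 * s ^ 2 * (curveY s U V - 4 * s ^ 2 * curveX s U V + 8 * s ^ 2 * (a * t ^ 4)) =
      4 * s ^ 4 / U ^ 3 * (V ^ 2 - (1 - 4 * U) * (4 * (a * t ^ 4) * U ^ 3 + s ^ 4)) := by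
    unfold curveX curveY
    field_simp
    ring
  have hne : 4 * s ^ 4 / U ^ 3 ≠ 0 := by simp [*]
  rw [OnQuartic, ← sub_eq_zero, ← sub_eq_zero (a := U * _), key, mul_eq_zero, or_iff_right hne]

lemma OnQuartic.equation {a s t U V : K} (h : OnQuartic a s t U V) (hs : s ≠ 0) (hU : U ≠ 0) :
    (eulerCurve a s t).Equation (curveX s U V) (curveY s U V) := by
  rw [equation_eulerCurve_iff]
  have h1 := (onQuartic_iff hs hU).1 h
  have h2 := curveY_mul (s := s) V hU
  have h3 : 2 * s ^ 2 ≠ 0 := by simp [*]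
  refine mul_left_cancel₀ h3 ?_
  -- The product UYD is computed in two ways.
  linear_combination (curveX s U V ^ 2 + 64 * (a * t ^ 4) * s ^ 4) * h2 - curveY s U V * h1

lemma eq_of_curveX {s U V X : K} (hs : s ≠ 0) (hU : U ≠ 0) (hX : curveX s U V = X) :
    V = (X * U ^ 2 + 4 * s ^ 4 * U) / (2 * s ^ 2) - s ^ 2 := by
  rw [← hX]
  unfold curveX
  field_simp
  ring

/-- The inverse of the map from the quartic to the elliptic curve. -/
lemma exists_onQuartic {a s t X Y : K} (hs : s ≠ 0)
    (h : (eulerCurve a s t).Equation X Y) (hX : X ^ 2 + 64 * (a * t ^ 4) * s ^ 4 ≠ 0)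
    (hP : ¬ (X = 4 * s ^ 4 ∧ Y = 16 * s ^ 6 - 8 * s ^ 2 * (a * t ^ 4))) :
    ∃ U V, U ≠ 0 ∧ OnQuartic a s t U V ∧ curveX s U V = X ∧ curveY s U V = Y := by
  rw [equation_eulerCurve_iff] at h
  set N := Y - 4 * s ^ 2 * X + 8 * s ^ 2 * (a * t ^ 4) with hN
  set D := X ^ 2 + 64 * (a * t ^ 4) * s ^ 4 with hD
  -- With D ≠ 0, N = 0 forces X = 4s⁴, and then N = 0 determines Y: the point is P.
  have hN0 : N ≠ 0 := by
    intro h0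
    rw [h0, mul_zero, eq_comm, mul_eq_zero, or_iff_left hX, sub_eq_zero] at h
    refine hP ⟨h, ?_⟩
    rw [h] at hN
    linear_combination h0 - hN
  have hY : Y = (X - 4 * s ^ 4) * D / N := by rw [eq_div_iff hN0, h]
  obtain ⟨U, hU⟩ : ∃ U, U = 2 * s ^ 2 * N / D := ⟨_, rfl⟩
  obtain ⟨V, hV⟩ : ∃ V, V = (X * U ^ 2 + 4 * s ^ 4 * U) / (2 * s ^ 2) - s ^ 2 := ⟨_, rfl⟩
  have hU0 : U ≠ 0 := by
    rw [hU]
    exact div_ne_zero (by simp [hs, hN0]) hX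
  have hVX : curveX s U V = X := by
    rw [hV]
    unfold curveX
    field_simp
    ring
  have hVY : curveY s U V = Y := by
    refine mul_right_cancel₀ hU0 ?_
    rw [curveY_mul V hU0, hVX, hY, hU]
    field_simp
  refine ⟨U, V, hU0, ?_, hVX, hVY⟩
  rw [onQuartic_iff hs hU0, hVX, hVY, ← hN, ← hD, hU]
  field_simp

/-- A description of the correspondence by the points of the quartic. -/
lemma corresponds_iff {a s t : K} (ha : a ≠ 0) (hs : s ≠ 0) (ht : t ≠ 0)
    (hd : a * t ^ 4 + 16 * s ^ 4 ≠ 0) (p : K × K × K) (Q : (eulerCurve a s t).Point) :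
    Corresponds a s t p Q ↔ ∃ U V : K, U ≠ 0 ∧ V ≠ 0 ∧ 1 - 4 * U ≠ 0 ∧ OnQuartic a s t U V ∧
      p = eulerTriple a s t U 1 (3 * s ^ 2 * V / (1 - 4 * U)) ∧
      ∃ h : (eulerCurve a s t).Nonsingular (curveX s U V) (curveY s U V),
        Q = WeierstrassCurve.Affine.Point.some _ _ h := by
  constructor
  · rintro ⟨A, B, C, hA, hB, hC, rfl, hsol, hQ⟩
    rw [isSolution_eulerTriple_iff_cubic ha hs ht hA hB hC,
      cubic_iff_quartic C hs hA hB hd] at hsol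
    obtain ⟨hU, hV⟩ := hsol
    have h4 : 1 - 4 * (A / B) ≠ 0 := fun h0 => hU (by linear_combination (-1 / 4) * h0)
    refine ⟨A / B, quarticV s A B C, div_ne_zero hA hB, ?_, h4, ?_, ?_, hQ⟩
    · unfold quarticV
      exact div_ne_zero (mul_ne_zero hC h4) (by simp [*])
    · unfold OnQuartic
      linear_combination hV
    · rw [eulerTriple_eq_div a s t A C hB]
      congr 1
      rw [eq_div_iff h4]
      unfold quarticV
      field_simp
  · rintro ⟨U, V, hU, hV, h4, hq, rfl, hQ⟩
    have hC : 3 * s ^ 2 * V / (1 - 4 * U) ≠ 0 := div_ne_zero (by simp [*]) h4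
    have hqV : quarticV s U 1 (3 * s ^ 2 * V / (1 - 4 * U)) = V := by
      unfold quarticV
      field_simp
    refine ⟨U, 1, _, hU, one_ne_zero, hC, rfl, ?_, ?_⟩
    · rw [isSolution_eulerTriple_iff_cubic ha hs ht hU one_ne_zero hC,
        cubic_iff_quartic _ hs hU one_ne_zero hd, hqV, div_one]
      refine ⟨fun h => h4 (by rw [h]; norm_num), ?_⟩
      unfold OnQuartic at hq
      linear_combination hq
    · rwa [hqV, div_one]

/-- The parameters are nondegenerate: the elliptic curve is smooth. -/
structure Nondegenerate (a s t : K) : Prop where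
  ha : a ≠ 0
  hs : s ≠ 0
  ht : t ≠ 0
  hd : a * t ^ 4 + 16 * s ^ 4 ≠ 0

namespace Nondegenerate

variable {a s t : K} (H : Nondegenerate a s t)
include H

lemma isElliptic : (eulerCurve a s t).IsElliptic := by
  obtain ⟨ha, hs, ht, hd⟩ := H
  refine ⟨IsUnit.mk0 _ ?_⟩
  rw [eulerCurve_Δ]
  simp [*]

lemma nonsingular {X Y : K} (h : (eulerCurve a s t).Equation X Y) :
    (eulerCurve a s t).Nonsingular X Y :=
  haveI := H.isElliptic
  WeierstrassCurve.Affine.equation_iff_nonsingular.1 h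

lemma nonsingular_P :
    (eulerCurve a s t).Nonsingular (4 * s ^ 4) (16 * s ^ 6 - 8 * s ^ 2 * (a * t ^ 4)) := by
  refine H.nonsingular ((equation_eulerCurve_iff ..).2 ?_)
  ring

lemma nonsingular_T : (eulerCurve a s t).Nonsingular (16 * s ^ 4) (96 * s ^ 6) := by
  refine H.nonsingular ((equation_eulerCurve_iff ..).2 ?_)
  ring

lemma point_unique {p : K × K × K} {Q Q' : (eulerCurve a s t).Point}
    (h : Corresponds a s t p Q) (h' : Corresponds a s t p Q') : Q = Q' := by
  obtain ⟨ha, hs, ht, hd⟩ := H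
  rw [corresponds_iff ha hs ht hd] at h h'
  obtain ⟨U, V, hU, hV, h4, -, rfl, hn, rfl⟩ := h
  obtain ⟨U', V', hU', hV', h4', -, hp, hn', rfl⟩ := h'
  have hC' : 3 * s ^ 2 * V' / (1 - 4 * U') ≠ 0 := div_ne_zero (by simp [*]) h4'
  obtain ⟨rfl, hW⟩ := eulerTriple_one_injective hs ht hU hU' hC' hp
  have hVV : V = V' := by
    field_simp at hW
    exact hW
  subst hVV
  rfl

lemma exists_point {p : K × K × K} (h : IsEulerSolution a s t p) :
    ∃ Q, Corresponds a s t p Q := by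
  obtain ⟨A, B, C, hA, hB, hC, hp, hsol⟩ := h
  have hq := (isSolution_eulerTriple_iff_cubic H.ha H.hs H.ht hA hB hC).1 (hp ▸ hsol)
  rw [cubic_iff_quartic C H.hs hA hB H.hd] at hq
  have hq' : OnQuartic a s t (A / B) (quarticV s A B C) := by
    unfold OnQuartic
    linear_combination hq.2
  exact ⟨_, A, B, C, hA, hB, hC, hp, hsol,
    H.nonsingular (hq'.equation H.hs (div_ne_zero hA hB)), rfl⟩

lemma ne_of_corresponds {p : K × K × K} {Q : (eulerCurve a s t).Point}
    (h : Corresponds a s t p Q)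
    (hP : (eulerCurve a s t).Nonsingular (4 * s ^ 4) (16 * s ^ 6 - 8 * s ^ 2 * (a * t ^ 4)))
    (hT : (eulerCurve a s t).Nonsingular (16 * s ^ 4) (96 * s ^ 6)) :
    Q ≠ 0 ∧ Q ≠ WeierstrassCurve.Affine.Point.some _ _ hP ∧
      Q ≠ WeierstrassCurve.Affine.Point.some _ _ hT := by
  obtain ⟨ha, hs, ht, hd⟩ := H
  rw [corresponds_iff ha hs ht hd] at h
  obtain ⟨U, V, hU, hV, h4, hq, rfl, hn, rfl⟩ := h
  have h1 := (onQuartic_iff hs hU).1 hq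
  refine ⟨WeierstrassCurve.Affine.Point.some_ne_zero _, fun h => ?_, fun h => ?_⟩ <;>
  obtain ⟨hX, hY⟩ := WeierstrassCurve.Affine.Point.some.inj h <;> rw [hX, hY] at h1
  · have h2 := curveY_mul (s := s) V hU
    rw [hX, hY] at h2
    -- At P both relations say that U times a polynomial is zero; this combination eliminates at⁴.
    have h9 : 9 * s ^ 8 * U = 0 := by linear_combination s ^ 2 / 2 * h2 + h1 / 16
    simp_all
  · have h2 := curveY_mul (s := s) V hU
    rw [hX, hY] at h2
    refine h4 (mul_left_cancel₀ (pow_ne_zero 6 hs) ?_)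
    linear_combination -h2 / 24

lemma existsUnique_solution {X Y : K} (h : (eulerCurve a s t).Nonsingular X Y)
    (hcube : ∀ U : K, 4 * (a * t ^ 4) * U ^ 3 + s ^ 4 ≠ 0)
    (hX : X ^ 2 + 64 * (a * t ^ 4) * s ^ 4 ≠ 0)
    (hP : ¬ (X = 4 * s ^ 4 ∧ Y = 16 * s ^ 6 - 8 * s ^ 2 * (a * t ^ 4)))
    (hT : ¬ (X = 16 * s ^ 4 ∧ Y = 96 * s ^ 6)) :
    ∃! p : K × K × K,
      Corresponds a s t p (WeierstrassCurve.Affine.Point.some _ _ h) := by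
  obtain ⟨ha, hs, ht, hd⟩ := H
  obtain ⟨U, V, hU, hq, rfl, rfl⟩ := exists_onQuartic hs h.1 hX hP
  simp only [corresponds_iff ha hs ht hd]
  have h4 : 1 - 4 * U ≠ 0 := by
    intro h0
    refine hT ?_
    have hU4 : U = 1 / 4 := by linear_combination (-1 / 4) * h0
    have hV : V = 0 := by
      rw [OnQuartic, h0, zero_mul] at hq
      exact pow_eq_zero_iff two_ne_zero |>.1 hq
    subst hU4 hV
    unfold curveX curveY
    constructor <;> ring
  have hV : V ≠ 0 := by
    rintro rfl
    have := mul_ne_zero h4 (hcube U)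
    rw [OnQuartic] at hq
    exact this (by rw [← hq]; ring)
  refine ⟨_, ⟨U, V, hU, hV, h4, hq, rfl, h, rfl⟩, ?_⟩
  rintro p ⟨U', V', hU', hV', h4', hq', rfl, hn', hQ⟩
  obtain ⟨hXX, hYY⟩ := WeierstrassCurve.Affine.Point.some.inj hQ
  have h1 := (onQuartic_iff hs hU).1 hq
  have h1' := (onQuartic_iff hs hU').1 hq'
  rw [← hXX, ← hYY, ← h1] at h1'
  -- The point determines U through UD = 2s²N with D ≠ 0; then V is recovered from X, which is
  -- affine in V.
  obtain rfl := mul_right_cancel₀ hX h1'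
  rw [eq_of_curveX hs hU' hXX.symm, ← eq_of_curveX hs hU' rfl]

end Nondegenerate

end Euler

/-! ### Specialization of elements of a fraction field at a point. -/

section Reduction

variable {R K F : Type*} [CommRing R] [Field K] [Algebra R K] [IsFractionRing R K] [Field F]

/-- The element `z` of the fraction field of `R` is regular at the point `φ : R →+* F`, with
value `r`. -/
def ReducesTo (φ : R →+* F) (z : K) (r : F) : Prop :=
  ∃ f g : R, φ g ≠ 0 ∧ z * algebraMap R K g = algebraMap R K f ∧ r * φ g = φ f

namespace ReducesTo

variable {φ : R →+* F} {z z' : K} {r r' : F}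

omit [IsFractionRing R K] in
lemma of_algebraMap (f : R) : ReducesTo φ (algebraMap R K f) (φ f) :=
  ⟨f, 1, by simp, by simp, by simp⟩

omit [IsFractionRing R K] in
lemma ofNat (n : ℕ) [n.AtLeastTwo] : ReducesTo φ (OfNat.ofNat n : K) (OfNat.ofNat n) := by
  have h := of_algebraMap (K := K) (φ := φ) (OfNat.ofNat n)
  rwa [map_ofNat, map_ofNat] at h

omit [IsFractionRing R K] in
lemma add (h : ReducesTo φ z r) (h' : ReducesTo φ z' r') : ReducesTo φ (z + z') (r + r') := by
  obtain ⟨f, g, hg, hz, hr⟩ := h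
  obtain ⟨f', g', hg', hz', hr'⟩ := h'
  refine ⟨f * g' + f' * g, g * g', by simp [hg, hg'], ?_, ?_⟩
  · simp only [map_mul, map_add, ← hz, ← hz']
    ring
  · simp only [map_mul, map_add, ← hr, ← hr']
    ring

omit [IsFractionRing R K] in
lemma mul (h : ReducesTo φ z r) (h' : ReducesTo φ z' r') : ReducesTo φ (z * z') (r * r') := by
  obtain ⟨f, g, hg, hz, hr⟩ := h
  obtain ⟨f', g', hg', hz', hr'⟩ := h'
  refine ⟨f * f', g * g', by simp [hg, hg'], ?_, ?_⟩
  · simp only [map_mul, ← hz, ← hz']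
    ring
  · simp only [map_mul, ← hr, ← hr']
    ring

omit [IsFractionRing R K] in
lemma neg (h : ReducesTo φ z r) : ReducesTo φ (-z) (-r) := by
  obtain ⟨f, g, hg, hz, hr⟩ := h
  exact ⟨-f, g, hg, by simp [← hz], by simp [← hr]⟩

omit [IsFractionRing R K] in
lemma sub (h : ReducesTo φ z r) (h' : ReducesTo φ z' r') : ReducesTo φ (z - z') (r - r') := by
  rw [sub_eq_add_neg, sub_eq_add_neg]
  exact h.add h'.neg

omit [IsFractionRing R K] in
lemma pow (h : ReducesTo φ z r) (n : ℕ) : ReducesTo φ (z ^ n) (r ^ n) := by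
  obtain ⟨f, g, hg, hz, hr⟩ := h
  exact ⟨f ^ n, g ^ n, by simp [hg], by simp [← hz, mul_pow], by simp [← hr, mul_pow]⟩

/-- Cross-multiplying two representations of z gives an identity in R, since R embeds in K; `φ`
carries it to F, where both denominators are nonzero. -/
lemma unique (h : ReducesTo φ z r) (h' : ReducesTo φ z r') : r = r' := by
  obtain ⟨f, g, hg, hz, hr⟩ := h
  obtain ⟨f', g', hg', hz', hr'⟩ := h'
  have h1 : f * g' = f' * g := by
    refine IsFractionRing.injective R K ?_
    simp only [map_mul, ← hz, ← hz']
    ring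
  have h2 := congrArg φ h1
  simp only [map_mul, ← hr, ← hr'] at h2
  have h3 : φ g * φ g' ≠ 0 := mul_ne_zero hg hg'
  refine mul_right_cancel₀ h3 ?_
  linear_combination h2

lemma ne (h : ReducesTo φ z r) (h' : ReducesTo φ z' r') (hne : r ≠ r') : z ≠ z' := by
  rintro rfl
  exact hne (h.unique h')

lemma ne_zero (h : ReducesTo φ z r) (hr : r ≠ 0) : z ≠ 0 :=
  h.ne (by simpa using of_algebraMap (K := K) (φ := φ) 0) hr

lemma div (h : ReducesTo φ z r) (h' : ReducesTo φ z' r') (hr' : r' ≠ 0) :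
    ReducesTo φ (z / z') (r / r') := by
  have hz0 := h'.ne_zero hr'
  obtain ⟨f, g, hg, hz, hr⟩ := h
  obtain ⟨f', g', hg', hz', hrr'⟩ := h'
  refine ⟨f * g', g * f', ?_, ?_, ?_⟩
  · rw [map_mul, ← hrr']
    exact mul_ne_zero hg (mul_ne_zero hr' hg')
  · simp only [map_mul, ← hz, ← hz']
    field_simp
  · simp only [map_mul, ← hr, ← hrr']
    field_simp

omit [IsFractionRing R K] in
lemma congr (h : ReducesTo φ z r) (hz : z = z') (hr : r = r') : ReducesTo φ z' r' := by
  subst hz hr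
  exact h

end ReducesTo

end Reduction

/-! ### The multiples of P, through the cuspidal reduction. -/

section Multiples

open WeierstrassCurve.Affine

variable {R K : Type*} [CommRing R] [Field K] [CharZero K] [DecidableEq K] [Algebra R K] [IsFractionRing R K]
  {φ : R →+* ℚ} {a s t : K}

/-- The reduction of the curve at `s = 1`, `at⁴ = 0` is cuspidal, and the multiples of `P` reduce
to the multiples of `(4, 16)` on `(Y - 2X)² = X³`. -/
def HasReduction (φ : R →+* ℚ) (a s t : K) (Q : (eulerCurve a s t).Point) (n : ℚ) : Prop :=
  ∃ X Y, ∃ h : (eulerCurve a s t).Nonsingular X Y, Q = Point.some _ _ h ∧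
    ReducesTo φ X (4 / n ^ 2) ∧ ReducesTo φ Y (8 / n ^ 3 + 8 / n ^ 2)

omit [CharZero K] in
-- At n = 1 the chord formula would be 0/0, so the tangent is used there. Otherwise n ≠ ±1, so the
-- two X-coordinates have distinct reductions. The limiting slope is the same expression in n in
-- both cases.
lemma reducesTo_slope {X Y X' Y' : K} {n : ℚ} (hs : ReducesTo φ s 1)
    (he : ReducesTo φ (a * t ^ 4) 0) (hX : ReducesTo φ X (4 / n ^ 2))
    (hY : ReducesTo φ Y (8 / n ^ 3 + 8 / n ^ 2)) (hX' : ReducesTo φ X' 4)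
    (hY' : ReducesTo φ Y' 16) (h0 : n ≠ 0) (h1 : n + 1 ≠ 0)
    (hXY : n = 1 → X = X' ∧ Y = Y') :
    ReducesTo φ ((eulerCurve a s t).slope X X' Y Y') (2 * (2 * n ^ 2 + 2 * n + 1) / (n * (n + 1))) := by
  by_cases hn1 : n = 1
  · obtain ⟨rfl, rfl⟩ := hXY hn1
    subst hn1
    have hden : ReducesTo φ (Y - (eulerCurve a s t).negY X Y) 16 := by
      unfold negY eulerCurve
      refine (hY'.sub ((hY'.neg.sub (((ReducesTo.ofNat 4).neg.mul (hs.pow 2)).mul hX')).sub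
        (((ReducesTo.ofNat 8).mul (hs.pow 2)).mul he))).congr rfl (by norm_num)
    have hne := hden.ne_zero (by norm_num)
    rw [slope_of_Y_ne rfl (sub_ne_zero.1 hne)]
    have hnum : ReducesTo φ (3 * X ^ 2 + 2 * (eulerCurve a s t).a₂ * X + (eulerCurve a s t).a₄ -
        (eulerCurve a s t).a₁ * Y) 80 := by
      unfold eulerCurve
      exact ((((((ReducesTo.ofNat 3).mul (hX'.pow 2)).add (((ReducesTo.ofNat 2).mul
        ((ReducesTo.ofNat 4).neg.mul (hs.pow 4))).mul hX')).add
        (((ReducesTo.ofNat 64).mul he).mul (hs.pow 4))).sub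
        (((ReducesTo.ofNat 4).neg.mul (hs.pow 2)).mul hY'))).congr rfl (by norm_num)
    exact (hnum.div hden (by norm_num)).congr rfl (by norm_num)
  · have hn1' : n - 1 ≠ 0 := sub_ne_zero.2 hn1
    have hval : 4 / n ^ 2 - 4 = -4 * (n - 1) * (n + 1) / n ^ 2 := by
      field_simp
      ring
    have hval0 : 4 / n ^ 2 - 4 ≠ 0 := by
      rw [hval]
      simp [h0, h1, hn1']
    have hne := (hX.sub hX').ne_zero hval0
    rw [slope_of_X_ne (sub_ne_zero.1 hne)]
    refine ((hY.sub hY').div (hX.sub hX') hval0).congr rfl ?_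
    rw [hval]
    field_simp
    ring

omit [CharZero K] [DecidableEq K] [IsFractionRing R K] in
lemma reducesTo_P (hs : ReducesTo φ s 1) (he : ReducesTo φ (a * t ^ 4) 0) :
    ReducesTo φ (4 * s ^ 4) 4 ∧ ReducesTo φ (16 * s ^ 6 - 8 * s ^ 2 * (a * t ^ 4)) 16 :=
  ⟨((ReducesTo.ofNat 4).mul (hs.pow 4)).congr rfl (by norm_num),
    (((ReducesTo.ofNat 16).mul (hs.pow 6)).sub
      (((ReducesTo.ofNat 8).mul (hs.pow 2)).mul he)).congr rfl (by norm_num)⟩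

lemma HasReduction.add (H : Nondegenerate a s t) (hs : ReducesTo φ s 1)
    (he : ReducesTo φ (a * t ^ 4) 0) {Q : (eulerCurve a s t).Point} {n : ℚ}
    (hQ : HasReduction φ a s t Q n) (h0 : 0 < n)
    (hXY : n = 1 → Q = Point.some _ _ H.nonsingular_P) :
    HasReduction φ a s t (Q + Point.some _ _ H.nonsingular_P) (n + 1) := by
  obtain ⟨X, Y, h, rfl, hX, hY⟩ := hQ
  obtain ⟨hX', hY'⟩ := reducesTo_P hs he
  have h1 : 0 < n + 1 := by positivity
  have hℓ := reducesTo_slope hs he hX hY hX' hY' h0.ne' h1.ne'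
    (fun hn => Point.some.inj (hXY hn))
  set ℓ := (eulerCurve a s t).slope X (4 * s ^ 4) Y (16 * s ^ 6 - 8 * s ^ 2 * (a * t ^ 4))
  have hneg : ∀ {x y : K} {p q : ℚ}, ReducesTo φ x p → ReducesTo φ y q →
      ReducesTo φ ((eulerCurve a s t).negY x y) (-q + 4 * p) := by
    intro x y p q hx hy
    unfold negY eulerCurve
    exact ((hy.neg.sub (((ReducesTo.ofNat 4).neg.mul (hs.pow 2)).mul hx)).sub
        (((ReducesTo.ofNat 8).mul (hs.pow 2)).mul he)).congr rfl (by ring)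
  -- The Y-coordinate of -P reduces to 0, whereas 8/n³ + 8/n² > 0 for n > 0; hence Q ≠ -P.
  have hne : ¬ (X = 4 * s ^ 4 ∧ Y = (eulerCurve a s t).negY (4 * s ^ 4)
      (16 * s ^ 6 - 8 * s ^ 2 * (a * t ^ 4))) := by
    rintro ⟨-, hYn⟩
    refine hY.ne (hneg hX' hY') ?_ hYn
    norm_num
    positivity
  have hXX : ReducesTo φ ((eulerCurve a s t).addX X (4 * s ^ 4) ℓ) (4 / (n + 1) ^ 2) := by
    unfold addX eulerCurve
    refine (((((hℓ.pow 2).add (((ReducesTo.ofNat 4).neg.mul (hs.pow 2)).mul hℓ)).sub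
      ((ReducesTo.ofNat 4).neg.mul (hs.pow 4))).sub hX).sub hX').congr rfl ?_
    field_simp
    ring
  refine ⟨_, _, _, Point.add_some hne, hXX, ?_⟩
  unfold addY negAddY
  refine (hneg hXX ((hℓ.mul (hXX.sub hX)).add hY)).congr rfl ?_
  field_simp
  ring

lemma hasReduction_nsmul (H : Nondegenerate a s t) (hs : ReducesTo φ s 1)
    (he : ReducesTo φ (a * t ^ 4) 0) {n : ℕ} (hn : 1 ≤ n) :
    HasReduction φ a s t (n • Point.some _ _ H.nonsingular_P) n := by
  induction n, hn using Nat.le_induction with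
  | base =>
    obtain ⟨hX', hY'⟩ := reducesTo_P hs he
    exact ⟨_, _, H.nonsingular_P, one_smul .., hX'.congr rfl (by norm_num),
      hY'.congr rfl (by norm_num)⟩
  | succ n hn ih =>
    rw [succ_nsmul, Nat.cast_succ]
    refine ih.add H hs he (by positivity) fun h => ?_
    rw [Nat.cast_eq_one.1 h, one_smul]

omit [CharZero K] [DecidableEq K] [IsFractionRing R K] in
lemma HasReduction.neg (hs : ReducesTo φ s 1) (he : ReducesTo φ (a * t ^ 4) 0)
    {Q : (eulerCurve a s t).Point} {n : ℚ} (hQ : HasReduction φ a s t Q n) :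
    HasReduction φ a s t (-Q) (-n) := by
  obtain ⟨X, Y, h, rfl, hX, hY⟩ := hQ
  refine ⟨_, _, _, Point.neg_some h, hX.congr rfl (by ring), ?_⟩
  unfold negY eulerCurve
  refine ((hY.neg.sub (((ReducesTo.ofNat 4).neg.mul (hs.pow 2)).mul hX)).sub
    (((ReducesTo.ofNat 8).mul (hs.pow 2)).mul he)).congr rfl ?_
  -- At n = 0 the convention x / 0 = 0 makes both sides zero.
  by_cases hn : n = 0
  · simp [hn]
  field_simp
  ring

lemma hasReduction_zsmul (H : Nondegenerate a s t) (hs : ReducesTo φ s 1)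
    (he : ReducesTo φ (a * t ^ 4) 0) {n : ℤ} (hn : n ≠ 0) :
    HasReduction φ a s t (n • Point.some _ _ H.nonsingular_P) n := by
  obtain ⟨m, rfl | rfl⟩ := n.eq_nat_or_neg
  · rw [natCast_zsmul]
    exact hasReduction_nsmul H hs he (by omega)
  · rw [neg_smul, natCast_zsmul, Int.cast_neg]
    exact (hasReduction_nsmul H hs he (by omega)).neg hs he

lemma nsmul_P_ne_zero (H : Nondegenerate a s t) (hs : ReducesTo φ s 1)
    (he : ReducesTo φ (a * t ^ 4) 0) {n : ℕ} (hn : 0 < n) :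
    n • Point.some _ _ H.nonsingular_P ≠ 0 := by
  obtain ⟨X, Y, h, hQ, -⟩ := hasReduction_nsmul H hs he hn
  rw [hQ]
  exact Point.some_ne_zero _

lemma zsmul_P_injective (H : Nondegenerate a s t) (hs : ReducesTo φ s 1)
    (he : ReducesTo φ (a * t ^ 4) 0) :
    Function.Injective fun n : ℤ => n • Point.some _ _ H.nonsingular_P := by
  intro m n hmn
  by_contra hne
  obtain ⟨X, Y, h, hQ, -⟩ := hasReduction_zsmul H hs he (sub_ne_zero.2 hne)
  rw [sub_smul, sub_eq_zero.2 hmn] at hQ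
  exact Point.some_ne_zero _ hQ.symm

lemma existsUnique_solution_zsmul (H : Nondegenerate a s t) (hs : ReducesTo φ s 1)
    (he : ReducesTo φ (a * t ^ 4) 0) (hcube : ∀ U : K, 4 * (a * t ^ 4) * U ^ 3 + s ^ 4 ≠ 0)
    {n : ℤ} (h0 : n ≠ 0) (h1 : n ≠ 1) :
    ∃! p : K × K × K, Corresponds a s t p (n • Point.some _ _ H.nonsingular_P) := by
  obtain ⟨X, Y, h, hQ, hX, hY⟩ := hasReduction_zsmul H hs he h0
  have hnQ : (n : ℚ) ≠ 0 := Int.cast_ne_zero.2 h0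
  have hP : ¬ (X = 4 * s ^ 4 ∧ Y = 16 * s ^ 6 - 8 * s ^ 2 * (a * t ^ 4)) := by
    rintro ⟨rfl, rfl⟩
    refine h1 (zsmul_P_injective H hs he ?_)
    simpa using hQ
  rw [hQ]
  refine H.existsUnique_solution h hcube ?_ hP ?_
  -- The value of D under the reduction is (4/n²)².
  · refine ((hX.pow 2).add (((ReducesTo.ofNat 64).mul he).mul (hs.pow 4))).ne_zero ?_
    simpa using hnQ
  · rintro ⟨rfl, -⟩
    -- Being T would give 4/n² = 16, that is 4n² = 1, impossible for an integer.
    have h4 := hX.unique ((ReducesTo.ofNat 16).mul (hs.pow 4))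
    field_simp at h4
    have h5 : (1 : ℤ) = 4 * n ^ 2 := by
      have : (1 : ℚ) = 4 * n ^ 2 := by linear_combination h4 / 4
      exact_mod_cast this
    omega

end Multiples

/-! ### Explicit computation of 2P and 3P. -/

section SmallMultiples

open WeierstrassCurve.Affine

variable {K : Type*} [Field K] [CharZero K] [DecidableEq K] {a s t : K}

/-- The factor of degree 8 in Euler's solution. -/
def eulerC (a s t : K) : K := 2 * a ^ 2 * t ^ 8 + 10 * a * s ^ 4 * t ^ 4 - s ^ 8

omit [CharZero K] [DecidableEq K] in
lemma eulerC_eq (a s t : K) :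
    eulerC a s t = 2 * (a * t ^ 4) ^ 2 + 10 * (a * t ^ 4) * s ^ 4 - s ^ 8 := by
  unfold eulerC
  ring

omit [CharZero K] [DecidableEq K] in
lemma newG_eq (a s t : K) :
    newG a s t = (a * t ^ 4) ^ 2 - 5 * s ^ 8 + 14 * (a * t ^ 4) * s ^ 4 := by
  unfold newG
  ring

omit [CharZero K] [DecidableEq K] in
lemma newH_eq (a s t : K) :
    newH a s t = (a * t ^ 4) ^ 3 + 3 * s ^ 4 * (a * t ^ 4) ^ 2 + 111 * (a * t ^ 4) * s ^ 8
      + s ^ 12 := by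
  unfold newH
  ring

omit [CharZero K] [DecidableEq K] in
lemma newD_eq (a s t : K) :
    newD a s t = (a * t ^ 4) ^ 6 + 6 * s ^ 4 * (a * t ^ 4) ^ 5 - 255 * s ^ 8 * (a * t ^ 4) ^ 4
      - 790 * (a * t ^ 4) ^ 3 * s ^ 12 - 2253 * (a * t ^ 4) ^ 2 * s ^ 16
      - 264 * s ^ 20 * (a * t ^ 4) + s ^ 24 := by
  unfold newD
  ring

omit [DecidableEq K] in
lemma corresponds_of_eq (H : Nondegenerate a s t) {p : K × K × K} {X Y A B C V : K}
    (h : (eulerCurve a s t).Nonsingular X Y) (hA : A ≠ 0) (hB : B ≠ 0) (hC : C ≠ 0)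
    (hp : p = eulerTriple a s t A B C)
    (hcubic : 36 * a * s ^ 4 * t ^ 4 * A ^ 3 + 9 * s ^ 8 * B ^ 3 + 4 * C ^ 2 * A = C ^ 2 * B)
    (hV : quarticV s A B C = V) (hX : curveX s (A / B) V = X) (hY : curveY s (A / B) V = Y) :
    Corresponds a s t p (Point.some _ _ h) := by
  subst hV hX hY
  exact ⟨A, B, C, hA, hB, hC, hp,
    hp ▸ (isSolution_eulerTriple_iff_cubic H.ha H.hs H.ht hA hB hC).2 hcubic, h, rfl⟩

lemma slope_P_P (H : Nondegenerate a s t) (hD : a * t ^ 4 - 2 * s ^ 4 ≠ 0) :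
    (16 * s ^ 6 - 8 * s ^ 2 * (a * t ^ 4) ≠ (eulerCurve a s t).negY (4 * s ^ 4)
      (16 * s ^ 6 - 8 * s ^ 2 * (a * t ^ 4))) ∧
    (eulerCurve a s t).slope (4 * s ^ 4) (4 * s ^ 4) (16 * s ^ 6 - 8 * s ^ 2 * (a * t ^ 4))
      (16 * s ^ 6 - 8 * s ^ 2 * (a * t ^ 4)) =
      -s ^ 2 * (10 * s ^ 4 + 4 * (a * t ^ 4)) / (a * t ^ 4 - 2 * s ^ 4) := by
  have hs := H.hs
  have hsub : (16 * s ^ 6 - 8 * s ^ 2 * (a * t ^ 4)) - (eulerCurve a s t).negY (4 * s ^ 4)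
      (16 * s ^ 6 - 8 * s ^ 2 * (a * t ^ 4)) = -8 * s ^ 2 * (a * t ^ 4 - 2 * s ^ 4) := by
    simp only [negY, eulerCurve]
    ring
  have hne : -8 * s ^ 2 * (a * t ^ 4 - 2 * s ^ 4) ≠ 0 := by simp [hs, hD]
  have hY := sub_ne_zero.1 (hsub ▸ hne)
  refine ⟨hY, ?_⟩
  rw [slope_of_Y_ne rfl hY, hsub, div_eq_div_iff hne hD]
  simp only [eulerCurve]
  ring

lemma two_nsmul_P (H : Nondegenerate a s t) (hD : a * t ^ 4 - 2 * s ^ 4 ≠ 0) :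
    ∃ h, 2 • Point.some _ _ H.nonsingular_P =
      Point.some (W' := eulerCurve a s t)
        (4 * s ^ 4 + 12 * s ^ 4 * eulerC a s t / (a * t ^ 4 - 2 * s ^ 4) ^ 2)
        (24 * s ^ 6 * eulerC a s t * (4 * (a * t ^ 4) + s ^ 4) / (a * t ^ 4 - 2 * s ^ 4) ^ 3) h := by
  obtain ⟨hne, hslope⟩ := slope_P_P H hD
  have hs := H.hs
  -- Free coordinates allow substitution although the nonsingularity proof depends on them.
  suffices h : ∀ X Y, (eulerCurve a s t).addX (4 * s ^ 4) (4 * s ^ 4)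
      ((eulerCurve a s t).slope (4 * s ^ 4) (4 * s ^ 4) (16 * s ^ 6 - 8 * s ^ 2 * (a * t ^ 4))
      (16 * s ^ 6 - 8 * s ^ 2 * (a * t ^ 4))) = X → (eulerCurve a s t).addY (4 * s ^ 4) (4 * s ^ 4)
      (16 * s ^ 6 - 8 * s ^ 2 * (a * t ^ 4))
      ((eulerCurve a s t).slope (4 * s ^ 4) (4 * s ^ 4) (16 * s ^ 6 - 8 * s ^ 2 * (a * t ^ 4))
      (16 * s ^ 6 - 8 * s ^ 2 * (a * t ^ 4))) = Y →
      ∃ h, 2 • Point.some _ _ H.nonsingular_P = Point.some (W' := eulerCurve a s t) X Y h by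
    refine h _ _ ?_ ?_
    · rw [hslope]
      simp only [addX, eulerCurve, eulerC_eq]
      obtain ⟨D, hDe⟩ : ∃ D, a * t ^ 4 - 2 * s ^ 4 = D := ⟨_, rfl⟩
      rw [hDe] at hD ⊢
      rw [sub_eq_iff_eq_add.1 hDe]
      field_simp
      ring
    · rw [hslope]
      simp only [addY, negAddY, negY, addX, eulerCurve, eulerC_eq]
      obtain ⟨D, hDe⟩ : ∃ D, a * t ^ 4 - 2 * s ^ 4 = D := ⟨_, rfl⟩
      rw [hDe] at hD ⊢
      rw [sub_eq_iff_eq_add.1 hDe]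
      field_simp
      ring
  rintro _ _ rfl rfl
  exact ⟨_, (two_nsmul _).trans (Point.add_self_of_Y_ne hne)⟩

lemma corresponds_two_nsmul (H : Nondegenerate a s t) (hD : a * t ^ 4 - 2 * s ^ 4 ≠ 0)
    (hB : 4 * a * t ^ 4 + s ^ 4 ≠ 0) (hC : eulerC a s t ≠ 0) :
    Corresponds a s t (euler1749 a s t) (2 • Point.some _ _ H.nonsingular_P) := by
  obtain ⟨h, hQ⟩ := two_nsmul_P H hD
  rw [hQ]
  have hs := H.hs
  have hV : quarticV s (a * t ^ 4 - 2 * s ^ 4) (4 * a * t ^ 4 + s ^ 4) (eulerC a s t) =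
      3 * s ^ 2 * eulerC a s t / (4 * a * t ^ 4 + s ^ 4) ^ 2 := by
    unfold quarticV
    field_simp
    ring
  refine corresponds_of_eq H h hD hB hC rfl ?_ hV ?_ ?_
  · unfold eulerC
    ring
  · unfold curveX
    rw [add_comm (4 * s ^ 4)]
    field_simp
    unfold eulerC
    ring
  · unfold curveY
    field_simp
    unfold eulerC
    ring

lemma slope_two_nsmul_P (H : Nondegenerate a s t) (hD : a * t ^ 4 - 2 * s ^ 4 ≠ 0)
    (hc : eulerC a s t ≠ 0) :
    (eulerCurve a s t).slope (4 * s ^ 4 + 12 * s ^ 4 * eulerC a s t / (a * t ^ 4 - 2 * s ^ 4) ^ 2)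
      (4 * s ^ 4)
      (24 * s ^ 6 * eulerC a s t * (4 * (a * t ^ 4) + s ^ 4) / (a * t ^ 4 - 2 * s ^ 4) ^ 3)
      (16 * s ^ 6 - 8 * s ^ 2 * (a * t ^ 4)) =
    2 * (3 * s ^ 4 * eulerC a s t * (s ^ 4 + 4 * (a * t ^ 4)) + (a * t ^ 4 - 2 * s ^ 4) ^ 4) /
      (3 * s ^ 2 * eulerC a s t * (a * t ^ 4 - 2 * s ^ 4)) := by
  have hs := H.hs
  have hne : 12 * s ^ 4 * eulerC a s t / (a * t ^ 4 - 2 * s ^ 4) ^ 2 ≠ 0 :=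
    div_ne_zero (by simp [hs, hc]) (pow_ne_zero 2 hD)
  rw [slope_of_X_ne (by simpa using hne), add_sub_cancel_left]
  obtain ⟨c, hcc⟩ : ∃ c, eulerC a s t = c := ⟨_, rfl⟩
  obtain ⟨D, hDe⟩ : ∃ D, a * t ^ 4 - 2 * s ^ 4 = D := ⟨_, rfl⟩
  rw [hDe] at hD ⊢
  rw [hcc] at hc ⊢
  rw [sub_eq_iff_eq_add.1 hDe]
  field_simp
  ring

lemma three_nsmul_P (H : Nondegenerate a s t) (hD : a * t ^ 4 - 2 * s ^ 4 ≠ 0)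
    (hc : eulerC a s t ≠ 0) :
    ∃ h, 3 • Point.some _ _ H.nonsingular_P = Point.some (W' := eulerCurve a s t)
      (2 * (newD a s t * newG a s t + ((a * t ^ 4 + s ^ 4) * newH a s t) ^ 2 +
        6 * s ^ 4 * (a * t ^ 4 - 2 * s ^ 4) * eulerC a s t * ((a * t ^ 4 + s ^ 4) * newH a s t)) /
          (9 * s ^ 4 * (a * t ^ 4 - 2 * s ^ 4) ^ 2 * eulerC a s t ^ 2))
      (-4 * ((a * t ^ 4 + s ^ 4) * newH a s t) * (newD a s t * newG a s t +
        ((a * t ^ 4 + s ^ 4) * newH a s t) ^ 2 +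
        6 * s ^ 4 * (a * t ^ 4 - 2 * s ^ 4) * eulerC a s t * ((a * t ^ 4 + s ^ 4) * newH a s t) -
          18 * s ^ 8 * (a * t ^ 4 - 2 * s ^ 4) ^ 2 * eulerC a s t ^ 2) /
          (27 * s ^ 6 * (a * t ^ 4 - 2 * s ^ 4) ^ 3 * eulerC a s t ^ 3)) h := by
  obtain ⟨h2, hQ⟩ := two_nsmul_P H hD
  have hslope := slope_two_nsmul_P H hD hc
  have hs := H.hs
  have hX : 4 * s ^ 4 + 12 * s ^ 4 * eulerC a s t / (a * t ^ 4 - 2 * s ^ 4) ^ 2 ≠ 4 * s ^ 4 := by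
    have hne : 12 * s ^ 4 * eulerC a s t / (a * t ^ 4 - 2 * s ^ 4) ^ 2 ≠ 0 :=
      div_ne_zero (by simp [hs, hc]) (pow_ne_zero 2 hD)
    simpa using hne
  have hadd := Point.add_of_X_ne (h₁ := h2) (h₂ := H.nonsingular_P) hX
  rw [← hQ, ← succ_nsmul] at hadd
  rw [hadd]
  suffices h : ∀ {X Y X' Y' : K} (h : (eulerCurve a s t).Nonsingular X Y), X = X' → Y = Y' →
      ∃ h', Point.some (W' := eulerCurve a s t) X Y h = Point.some X' Y' h' by
    refine h _ ?_ ?_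
    all_goals
      rw [hslope]
      simp only [addY, negAddY, negY, addX, eulerCurve]
      -- The denominators are kept as atoms c and D while they are cleared; with at⁴ = D + 2s⁴ and c
      -- expanded, a polynomial identity in D and s remains.
      obtain ⟨c, hcc⟩ : ∃ c, eulerC a s t = c := ⟨_, rfl⟩
      obtain ⟨D, hDe⟩ : ∃ D, a * t ^ 4 - 2 * s ^ 4 = D := ⟨_, rfl⟩
      have hc' := hcc
      rw [eulerC_eq] at hc'
      rw [newD_eq, newG_eq, newH_eq]
      rw [hcc] at hc ⊢
      rw [hDe] at hD ⊢
      rw [sub_eq_iff_eq_add.1 hDe] at hc' ⊢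
      field_simp
      rw [← hc']
      ring
  rintro X Y _ _ h rfl rfl
  exact ⟨h, rfl⟩

lemma corresponds_three_nsmul (H : Nondegenerate a s t) (hD : a * t ^ 4 - 2 * s ^ 4 ≠ 0)
    (hc : eulerC a s t ≠ 0) (hes : a * t ^ 4 + s ^ 4 ≠ 0) (hh : newH a s t ≠ 0)
    (hg : newG a s t ≠ 0) (hd : newD a s t ≠ 0) :
    Corresponds a s t (newSolution a s t) (3 • Point.some _ _ H.nonsingular_P) := by
  have hs := H.hs
  have ht := H.ht
  have hB : (a * t ^ 4 + s ^ 4) * newH a s t ≠ 0 := mul_ne_zero hes hh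
  obtain ⟨h, hQ⟩ := three_nsmul_P H hD hc
  rw [hQ]
  -- For A = -3s⁴(at⁴ - 2s⁴)c and B = (at⁴ + s⁴)h, these two identities say B - 4A = g² and s⁴B³ +
  -- 4at⁴A³ = s⁴d². They factor the two sides of the quartic, giving V = s²dg/B² and C = 3s⁴d/g.
  have hgB : newG a s t ^ 2 = (a * t ^ 4 + s ^ 4) * newH a s t +
      12 * s ^ 4 * (a * t ^ 4 - 2 * s ^ 4) * eulerC a s t := by
    rw [newG_eq, newH_eq, eulerC_eq]
    ring
  have hdB : newD a s t ^ 2 = ((a * t ^ 4 + s ^ 4) * newH a s t) ^ 3 -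
      108 * (a * t ^ 4) * s ^ 8 * (a * t ^ 4 - 2 * s ^ 4) ^ 3 * eulerC a s t ^ 3 := by
    rw [newD_eq, newH_eq, eulerC_eq]
    ring
  have hp : newSolution a s t = eulerTriple a s t (-3 * s ^ 4 * (a * t ^ 4 - 2 * s ^ 4) *
      eulerC a s t) ((a * t ^ 4 + s ^ 4) * newH a s t) (3 * s ^ 4 * newD a s t / newG a s t) := by
    have hcc : -s ^ 8 + 10 * a * t ^ 4 * s ^ 4 + 2 * a ^ 2 * t ^ 8 = eulerC a s t := by
      unfold eulerC
      ring
    have hDD : -2 * s ^ 4 + a * t ^ 4 = a * t ^ 4 - 2 * s ^ 4 := by ring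
    unfold newSolution eulerTriple
    rw [hcc, hDD]
    generalize a * t ^ 4 - 2 * s ^ 4 = D at *
    generalize a * t ^ 4 + s ^ 4 = M at *
    ext
    · field_simp
      ring
    · field_simp
      ring
    · field_simp
  generalize (a * t ^ 4 + s ^ 4) * newH a s t = B at *
  generalize a * t ^ 4 - 2 * s ^ 4 = D at *
  generalize eulerC a s t = c at *
  generalize newG a s t = g at *
  generalize newD a s t = d at *
  have hV : quarticV s (-3 * s ^ 4 * D * c) B (3 * s ^ 4 * d / g) = s ^ 2 * d * g / B ^ 2 := by
    have h4 : 1 - 4 * (-3 * s ^ 4 * D * c / B) = g ^ 2 / B := by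
      rw [hgB]
      field_simp
      ring
    unfold quarticV
    rw [h4]
    field_simp
  refine corresponds_of_eq H h (by simp [hs, hD, hc]) hB (by simp [hs, hd, hg]) hp ?_ hV ?_ ?_
  · have hC : (3 * s ^ 4 * d / g) ^ 2 * g ^ 2 = 9 * s ^ 8 * d ^ 2 := by
      field_simp
      ring
    linear_combination (-9 * s ^ 8) * hdB - hC + (3 * s ^ 4 * d / g) ^ 2 * hgB
  · unfold curveX
    field_simp
    ring
  · unfold curveY
    field_simp
    ring

end SmallMultiples

/-! ### Nonvanishing over the rational function field, and assembly. -/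

section Conclusion

open WeierstrassCurve.Affine

/-- The value α of a is arbitrary, because t reduces to 0 and so at⁴ does too. Each factor in the
formulas for 2P and 3P then reduces to the nonzero coefficient of its pure power of s. -/
lemma multiplesGiveInfinitelyMany_of_reducesTo {R K : Type*} [CommRing R] [Field K] [CharZero K]
    [DecidableEq K] [Algebra R K] [IsFractionRing R K] {φ : R →+* ℚ} {a s t : K} {α : ℚ}
    (H : Nondegenerate a s t) (hα : ReducesTo φ a α) (hs : ReducesTo φ s 1) (ht : ReducesTo φ t 0)
    (hcube : ∀ U : K, 4 * (a * t ^ 4) * U ^ 3 + s ^ 4 ≠ 0) :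
    MultiplesGiveInfinitelyMany a s t := by
  have he : ReducesTo φ (a * t ^ 4) 0 := (hα.mul (ht.pow 4)).congr rfl (by simp)
  have hD : a * t ^ 4 - 2 * s ^ 4 ≠ 0 :=
    (he.sub ((ReducesTo.ofNat 2).mul (hs.pow 4))).ne_zero (by norm_num)
  have hes : a * t ^ 4 + s ^ 4 ≠ 0 := (he.add (hs.pow 4)).ne_zero (by norm_num)
  have hB : 4 * a * t ^ 4 + s ^ 4 ≠ 0 := by
    rw [mul_assoc]
    exact (((ReducesTo.ofNat 4).mul he).add (hs.pow 4)).ne_zero (by norm_num)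
  have hc : eulerC a s t ≠ 0 := by
    rw [eulerC_eq]
    exact ((((ReducesTo.ofNat 2).mul (he.pow 2)).add
      (((ReducesTo.ofNat 10).mul he).mul (hs.pow 4))).sub (hs.pow 8)).ne_zero (by norm_num)
  have hg : newG a s t ≠ 0 := by
    rw [newG_eq]
    exact (((he.pow 2).sub ((ReducesTo.ofNat 5).mul (hs.pow 8))).add
      (((ReducesTo.ofNat 14).mul he).mul (hs.pow 4))).ne_zero (by norm_num)
  have hh : newH a s t ≠ 0 := by
    rw [newH_eq]
    exact ((((he.pow 3).add (((ReducesTo.ofNat 3).mul (hs.pow 4)).mul (he.pow 2))).add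
      (((ReducesTo.ofNat 111).mul he).mul (hs.pow 8))).add (hs.pow 12)).ne_zero (by norm_num)
  have hd : newD a s t ≠ 0 := by
    rw [newD_eq]
    exact (((((((he.pow 6).add (((ReducesTo.ofNat 6).mul (hs.pow 4)).mul (he.pow 5))).sub
      (((ReducesTo.ofNat 255).mul (hs.pow 8)).mul (he.pow 4))).sub
      (((ReducesTo.ofNat 790).mul (he.pow 3)).mul (hs.pow 12))).sub
      (((ReducesTo.ofNat 2253).mul (he.pow 2)).mul (hs.pow 16))).sub
      (((ReducesTo.ofNat 264).mul (hs.pow 20)).mul he)).add (hs.pow 24)).ne_zero (by norm_num)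
  have hex := fun {n : ℤ} => existsUnique_solution_zsmul (n := n) H hs he hcube
  have hinj : ∀ (m n : ℤ) (p : K × K × K),
      Corresponds a s t p (m • Point.some _ _ H.nonsingular_P) →
      Corresponds a s t p (n • Point.some _ _ H.nonsingular_P) → m = n :=
    fun m n p hm hn => zsmul_P_injective H hs he (H.point_unique hm hn)
  refine ⟨H.isElliptic, H.nonsingular_P, fun n hn => nsmul_P_ne_zero H hs he hn,
    fun n => hex, hinj, corresponds_two_nsmul H hD hB hc,
    corresponds_three_nsmul H hD hc hes hh hg hd, ?_⟩
  -- The shift by 2 avoids the excluded multiples 0 and 1.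
  choose p hp using fun n : ℕ => (hex (n := n + 2) (by omega) (by omega)).exists
  refine Set.infinite_of_injective_forall_mem (f := p) (fun m n hmn => ?_)
    fun n => (hp n).isEulerSolution
  have := hinj _ _ _ (hp m) (hmn ▸ hp n)
  omega

lemma nondegenerate_of_reducesTo {R K : Type*} [CommRing R] [Field K] [Algebra R K]
    [IsFractionRing R K] {φ : R →+* ℚ} {a s t : K} {α : ℚ} (ha : a ≠ 0) (ht0 : t ≠ 0)
    (hα : ReducesTo φ a α) (hs : ReducesTo φ s 1) (ht : ReducesTo φ t 0) :
    Nondegenerate a s t :=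
  ⟨ha, hs.ne_zero one_ne_zero, ht0,
    ((hα.mul (ht.pow 4)).add ((ReducesTo.ofNat 16).mul (hs.pow 4))).ne_zero (by norm_num)⟩

variable {n : ℕ}

lemma param_ne_zero (i : Fin n) : param i ≠ 0 := by
  simp [param]

open MvPolynomial in
-- For U = f/g, comparing degrees in the i-th variable would give 4 + 3 deg f = 3 deg g. The
-- coefficient q serves both for the indeterminate a and for a rational constant.
lemma add_pow_four_ne_zero {i j : Fin n} (hij : i ≠ j) {q : MvPolynomial (Fin n) ℚ} (hq : q ≠ 0)
    (hqi : degreeOf i q = 0) (U : ParamField n) :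
    4 * (algebraMap _ (ParamField n) q * param i ^ 4) * U ^ 3 + param j ^ 4 ≠ 0 := by
  intro h
  obtain ⟨f, g, hg, rfl⟩ := IsFractionRing.div_surjective (A := MvPolynomial (Fin n) ℚ) U
  have hg0 : g ≠ 0 := nonZeroDivisors.ne_zero hg
  have hf0 : f ≠ 0 := by
    rintro rfl
    simp [param_ne_zero] at h
  have hgK : algebraMap _ (ParamField n) g ≠ 0 := by simpa using hg0
  have h1 : C 4 * (q * X i ^ 4) * f ^ 3 = C (-1) * (X j ^ 4 * g ^ 3) := by
    apply IsFractionRing.injective (MvPolynomial (Fin n) ℚ) (ParamField n)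
    unfold param at h
    field_simp at h
    simp only [map_mul, map_pow, map_neg, map_one, map_ofNat]
    linear_combination h
  have h2 := congrArg (degreeOf i) h1
  have hX : ∀ k : Fin n, (X k : MvPolynomial (Fin n) ℚ) ≠ 0 := fun k => X_ne_zero k
  rw [degreeOf_mul_eq, degreeOf_mul_eq, degreeOf_mul_eq, degreeOf_mul_eq, degreeOf_mul_eq,
    degreeOf_pow_eq, degreeOf_pow_eq, degreeOf_pow_eq, degreeOf_pow_eq, degreeOf_X, degreeOf_X,
    degreeOf_C, degreeOf_C, hqi, if_pos rfl, if_neg hij] at h2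
  · omega
  all_goals simp [hX, hf0, hg0, hq]

open MvPolynomial in
-- For Z = f/g, degrees in the i-th variable would give 2 deg f = 1 + 2 deg g. This requires a to be
-- an indeterminate.
lemma sq_add_ne_zero {i j k : Fin n} (hij : i ≠ j) (hik : i ≠ k) (Z : ParamField n) :
    Z ^ 2 + 64 * (param i * param k ^ 4) * param j ^ 4 ≠ 0 := by
  intro h
  obtain ⟨f, g, hg, rfl⟩ := IsFractionRing.div_surjective (A := MvPolynomial (Fin n) ℚ) Z
  have hg0 : g ≠ 0 := nonZeroDivisors.ne_zero hg
  have hf0 : f ≠ 0 := by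
    rintro rfl
    simp [param_ne_zero] at h
  have hgK : algebraMap _ (ParamField n) g ≠ 0 := by simpa using hg0
  have h1 : f ^ 2 = C (-64) * ((X i * X k ^ 4) * X j ^ 4 * g ^ 2) := by
    apply IsFractionRing.injective (MvPolynomial (Fin n) ℚ) (ParamField n)
    unfold param at h
    field_simp at h
    simp only [map_mul, map_pow, map_neg, map_ofNat]
    linear_combination h
  have h2 := congrArg (degreeOf i) h1
  have hX : ∀ k : Fin n, (X k : MvPolynomial (Fin n) ℚ) ≠ 0 := fun k => X_ne_zero k
  rw [degreeOf_mul_eq, degreeOf_mul_eq, degreeOf_mul_eq, degreeOf_mul_eq,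
    degreeOf_pow_eq, degreeOf_pow_eq, degreeOf_pow_eq, degreeOf_pow_eq, degreeOf_X, degreeOf_X,
    degreeOf_X, degreeOf_C, if_pos rfl, if_neg hij, if_neg hik] at h2
  · omega
  all_goals simp [hX, hf0, hg0]

lemma reducesTo_param (v : Fin n → ℚ) (i : Fin n) :
    ReducesTo (MvPolynomial.eval v) (param i : ParamField n) (v i) :=
  (ReducesTo.of_algebraMap (MvPolynomial.X i)).congr rfl (MvPolynomial.eval_X i)

end Conclusion

theorem mainTheorem1 [DecidableEq (ParamField 3)] [DecidableEq (ParamField 2)] :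
    -- `a, s, t` are independent indeterminates over `ℚ`
    (∀ a s t : ParamField 3, a = param 0 → s = param 1 → t = param 2 →
      -- reduction of the equation for Euler's shape to the cubic relation and to the quartic
      (∀ A B C : ParamField 3, A ≠ 0 → B ≠ 0 → C ≠ 0 →
        (IsSolution a (eulerTriple a s t A B C) ↔
          36 * a * s ^ 4 * t ^ 4 * A ^ 3 + 9 * s ^ 8 * B ^ 3 + 4 * C ^ 2 * A = C ^ 2 * B) ∧
        (IsSolution a (eulerTriple a s t A B C) ↔
          A / B ≠ 1 / 4 ∧
          quarticV s A B C ^ 2 = -16 * a * t ^ 4 * (A / B) ^ 4 + 4 * a * t ^ 4 * (A / B) ^ 3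
            - 4 * s ^ 4 * (A / B) + s ^ 4)) ∧
      -- one-to-one correspondence of the solutions of Euler's shape with the points other than
      -- `O`, `P` and `T`
      (∃ (hP : (eulerCurve a s t).Nonsingular
            (4 * s ^ 4) (16 * s ^ 6 - 8 * s ^ 2 * (a * t ^ 4)))
          (hT : (eulerCurve a s t).Nonsingular (16 * s ^ 4) (96 * s ^ 6)),
        (∀ p : ParamField 3 × ParamField 3 × ParamField 3, IsEulerSolution a s t p →
          ∃! Q : (eulerCurve a s t).Point, Corresponds a s t p Q) ∧
        (∀ Q : (eulerCurve a s t).Point,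
          Q ≠ 0 → Q ≠ WeierstrassCurve.Affine.Point.some _ _ hP →
          Q ≠ WeierstrassCurve.Affine.Point.some _ _ hT →
          ∃! p : ParamField 3 × ParamField 3 × ParamField 3, Corresponds a s t p Q) ∧
        (∀ (p : ParamField 3 × ParamField 3 × ParamField 3) (Q : (eulerCurve a s t).Point),
          Corresponds a s t p Q →
          Q ≠ 0 ∧ Q ≠ WeierstrassCurve.Affine.Point.some _ _ hP ∧
          Q ≠ WeierstrassCurve.Affine.Point.some _ _ hT)) ∧
      -- the multiples of `P`
      MultiplesGiveInfinitelyMany a s t) ∧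
    -- the multiples of `P` for every fixed nonzero rational number `a` and indeterminates `s, t`
    (∀ a : ℚ, a ≠ 0 →
      MultiplesGiveInfinitelyMany (algebraMap ℚ (ParamField 2) a) (param 0) (param 1)) := by
  refine ⟨?_, fun a ha => ?_⟩
  · rintro a s t rfl rfl rfl
    have ha := reducesTo_param ![0, 1, 0] 0
    have hs := reducesTo_param ![0, 1, 0] 1
    have ht := reducesTo_param ![0, 1, 0] 2
    have H := nondegenerate_of_reducesTo (param_ne_zero 0) (param_ne_zero 2) ha hs ht
    have hcube := add_pow_four_ne_zero (i := (2 : Fin 3)) (j := 1) (by decide)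
      (MvPolynomial.X_ne_zero 0)
      (by rw [MvPolynomial.degreeOf_X, if_neg (by decide)])
    refine ⟨fun A B C hA hB hC => ?_, ⟨H.nonsingular_P, H.nonsingular_T, fun p hp => ?_,
      fun Q h0 hP hT => ?_, fun p Q h => H.ne_of_corresponds h _ _⟩,
      multiplesGiveInfinitelyMany_of_reducesTo H ha hs ht hcube⟩
    · have h := isSolution_eulerTriple_iff_cubic H.ha H.hs H.ht hA hB hC
      exact ⟨h, h.trans (cubic_iff_quartic C H.hs hA hB H.hd)⟩
    · obtain ⟨Q, hQ⟩ := H.exists_point hp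
      exact ⟨Q, hQ, fun Q' hQ' => H.point_unique hQ' hQ⟩
    · rcases Q with _ | ⟨X, Y, h⟩
      · exact absurd rfl h0
      · refine H.existsUnique_solution h hcube (sq_add_ne_zero (by decide) (by decide) X) ?_ ?_
        · rintro ⟨rfl, rfl⟩
          exact hP rfl
        · rintro ⟨rfl, rfl⟩
          exact hT rfl
  · have hs := reducesTo_param ![1, 0] 0
    have ht := reducesTo_param ![1, 0] 1
    rw [IsScalarTower.algebraMap_apply ℚ (MvPolynomial (Fin 2) ℚ) (ParamField 2),
      MvPolynomial.algebraMap_eq]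
    have haR := ReducesTo.of_algebraMap (K := ParamField 2) (φ := MvPolynomial.eval ![1, 0])
      (MvPolynomial.C a)
    have hC : (MvPolynomial.C a : MvPolynomial (Fin 2) ℚ) ≠ 0 := by simpa using ha
    have H := nondegenerate_of_reducesTo (by simpa using ha) (param_ne_zero 1) haR hs ht
    exact multiplesGiveInfinitelyMany_of_reducesTo H haR hs ht
      (add_pow_four_ne_zero (by decide) hC (MvPolynomial.degreeOf_C a 1))
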